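/- Let $G=(V,E)$ be a finite connected simple graph with a fixed plane embedding; "face" means bounded face. Let $M_G$ be the group generated by the central phases $\pm1,\pm i$, the vertices $v$ and the directed edges $e_{ij}$ of $G$, subject to $e_{ij}^2=v_j^2=1$, $e_{ij}=-e_{ji}$, $v_iv_j=v_jv_i$, where an edge and a vertex anticommute if they are incident and commute otherwise, and two edges anticommute if they share exactly one vertex and commute if they share none. Let $\mathcal C_G\le M_G$ be the cycle group, consisting of the elements $i^{n}\,e_{i_0i_1}e_{i_1i_2}\cdots e_{i_{n-1}i_0}$ of the closed walks of $G$ with $n$ edges. A fermionic encoding is a representation $\sigma$ of $M_G$ on the Hilbert space of $N$ qubits, with phases acting as scalars and with values in the Pauli group, such that $-1\notin\sigma(\mathcal C_G)$. With $M=|V|$ modes, stabilizer group $S=\sigma(\mathcal C_G)$, and $D(S)$ the least number of generators of $S$, its disparity is $\Delta=N-M-D(S)$. Let $K=\ker(\sigma|_{\mathcal C_G})$. A Weight-3 planar encoding is a fermionic encoding whose qubits are one vertex qubit for every vertex together with auxiliary qubits, each auxiliary qubit being associated with a face and each face with at most one auxiliary qubit, such that (up to phases) $\sigma(v)$ is a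 Pauli $Z$ on the vertex qubit of $v$, and $\sigma(e_{ij})$ is the product of a Pauli $X$ or $Y$ on each of the two vertex qubits of $i$ and $j$ and of a Pauli $X$, $Y$ or $Z$ on at most one auxiliary qubit, whose face is adjacent to the edge. Suppose that every face carrying an auxiliary qubit is bounded by a cycle, that is, the edges having this face on exactly one side are the edges of a simple cycle of $G$. Then the disparity of the Weight-3 planar encoding is $$\Delta = F_K - EF,$$ where $F_K$ is the number of faces whose face cycle (the element of $\mathcal C_G$ given by the closed boundary walk of the face) lies in $K$, and $EF$ is the number of faces without an auxiliary qubit. -/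

import Mathlib

namespace FermionicEncoding

/-! ### Multi-qubit Pauli operators -/

/-- The labels of the four single-qubit Pauli operators. -/
inductive Pauli
  | I
  | X
  | Y
  | Z
  deriving DecidableEq

instance : Finite Pauli :=
  Finite.of_surjective (![Pauli.I, Pauli.X, Pauli.Y, Pauli.Z]) fun p => by
    cases p
    exacts [⟨0, rfl⟩, ⟨1, rfl⟩, ⟨2, rfl⟩, ⟨3, rfl⟩]

/-- The `2 × 2` matrix of a single-qubit Pauli operator. -/
noncomputable def Pauli.mat : Pauli → Matrix (Fin 2) (Fin 2) ℂ
  | .I => 1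
  | .X => !![0, 1; 1, 0]
  | .Y => !![0, -Complex.I; Complex.I, 0]
  | .Z => !![1, 0; 0, -1]

/-- Operators on the Hilbert space `(ℂ²)^{⊗ Q}` of a finite set `Q` of qubits, written as matrices
in the computational basis, whose elements are the bit assignments `Q → Fin 2`. -/
abbrev QubitOp (Q : Type*) : Type _ := Matrix (Q → Fin 2) (Q → Fin 2) ℂ

/-- The tensor product over all qubits `q` of the single-qubit Pauli operators `P q`. -/
noncomputable def pauliString {Q : Type*} [Fintype Q] (P : Q → Pauli) : QubitOp Q :=
  Matrix.of fun x y => ∏ q, (P q).mat (x q) (y q)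

/-- The scalar `i ^ k`, for `k` modulo `4`. -/
noncomputable def iPow (k : ZMod 4) : ℂ := Complex.I ^ k.val

/-- `U` belongs to the multi-qubit Pauli group `{±1, ±i} × {I, X, Y, Z}^Q`. -/
def IsPauliOp {Q : Type*} [Fintype Q] (U : QubitOp Q) : Prop :=
  ∃ (k : ZMod 4) (P : Q → Pauli), U = iPow k • pauliString P

/-! ### The group `M_G` of a graph and its cycle subgroup -/

/-- Generators of `M_G`: the phases (`phase k` stands for `i ^ k`), the vertices, and the directed
edges of `G`. -/
inductive Gen {V : Type*} (G : SimpleGraph V)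
  | phase (k : ZMod 4)
  | vertex (v : V)
  | edge (d : G.Dart)

/-- The defining relations of `M_G`: `Rel G a b` says that the words `a` and `b` are identified.
The first three say that the phases form a central copy of `{1, i, -1, -i}`; `phase 2` is `-1`. -/
inductive Rel {V : Type*} (G : SimpleGraph V) : FreeGroup (Gen G) → FreeGroup (Gen G) → Prop
  | phase_mul (a b : ZMod 4) :
      Rel G (.of (.phase a) * .of (.phase b)) (.of (.phase (a + b)))
  | phase_vertex (a : ZMod 4) (v : V) :
      Rel G (.of (.phase a) * .of (.vertex v)) (.of (.vertex v) * .of (.phase a))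
  | phase_edge (a : ZMod 4) (d : G.Dart) :
      Rel G (.of (.phase a) * .of (.edge d)) (.of (.edge d) * .of (.phase a))
  | edge_sq (d : G.Dart) :
      Rel G (.of (.edge d) * .of (.edge d)) 1
  | vertex_sq (v : V) :
      Rel G (.of (.vertex v) * .of (.vertex v)) 1
  | edge_symm (d : G.Dart) :
      Rel G (.of (.edge d)) (.of (.phase 2) * .of (.edge d.symm))
  | vertex_comm (v w : V) :
      Rel G (.of (.vertex v) * .of (.vertex w)) (.of (.vertex w) * .of (.vertex v))
  | edge_vertex_comm (d : G.Dart) (v : V) (h₁ : v ≠ d.fst) (h₂ : v ≠ d.snd) :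
      Rel G (.of (.edge d) * .of (.vertex v)) (.of (.vertex v) * .of (.edge d))
  | edge_edge_comm (d d' : G.Dart) (h₁ : d.fst ≠ d'.fst) (h₂ : d.fst ≠ d'.snd)
      (h₃ : d.snd ≠ d'.fst) (h₄ : d.snd ≠ d'.snd) :
      Rel G (.of (.edge d) * .of (.edge d')) (.of (.edge d') * .of (.edge d))
  | edge_vertex_anticomm (d : G.Dart) :
      Rel G (.of (.edge d) * .of (.vertex d.snd))
        (.of (.phase 2) * (.of (.vertex d.snd) * .of (.edge d)))
  | edge_edge_anticomm (d d' : G.Dart) (h₁ : d.snd = d'.fst) (h₂ : d.fst ≠ d'.snd) :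
      Rel G (.of (.edge d) * .of (.edge d'))
        (.of (.phase 2) * (.of (.edge d') * .of (.edge d)))

/-- The finitely presented group `M_G`. -/
abbrev MajoranaGroup {V : Type*} (G : SimpleGraph V) : Type _ :=
  PresentedGroup {r : FreeGroup (Gen G) | ∃ a b, Rel G a b ∧ r = a * b⁻¹}

/-- The image in `M_G` of a generator. -/
def gen {V : Type*} {G : SimpleGraph V} (x : Gen G) : MajoranaGroup G :=
  PresentedGroup.of x

/-- `i ^ n` times the product of the `n` directed edges in the list `l`. -/
def pathElt {V : Type*} {G : SimpleGraph V} (l : List G.Dart) : MajoranaGroup G :=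
  gen (.phase (l.length : ZMod 4)) * (l.map fun d => gen (.edge d)).prod

/-- The cycle group `C_G`: the subgroup of `M_G` generated by the elements of the closed walks of
`G`. (For connected `G` these elements already form a subgroup.) -/
def cycleGroup {V : Type*} (G : SimpleGraph V) : Subgroup (MajoranaGroup G) :=
  Subgroup.closure {c | ∃ (v : V) (w : G.Walk v v), c = pathElt w.darts}

/-! ### Fermionic encodings and their disparity -/

/-- A fermionic encoding of the graph `G` into the qubits `Q`: a representation `σ` of `M_G` on the
qubit Hilbert space, in which the phases act as scalars, taking values in the Pauli group, such that
no element of the cycle group is mapped to `-1`. -/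
structure Encoding {V : Type*} (G : SimpleGraph V) (Q : Type*) [Fintype Q] [DecidableEq Q] where
  σ : MajoranaGroup G →* (QubitOp Q)ˣ
  phase_op : ∀ k : ZMod 4, (σ (gen (.phase k)) : QubitOp Q) = iPow k • 1
  isPauliOp : ∀ m : MajoranaGroup G, IsPauliOp (σ m : QubitOp Q)
  neg_one_notMem : (-1 : (QubitOp Q)ˣ) ∉ (cycleGroup G).map σ

namespace Encoding

variable {V : Type*} {G : SimpleGraph V} {Q : Type*} [Fintype Q] [DecidableEq Q]

/-- The stabilizer group `S = σ(C_G)`. -/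
def stabilizer (ε : Encoding G Q) : Subgroup (QubitOp Q)ˣ := (cycleGroup G).map ε.σ

/-- `K`, the group of all cycles that are mapped to the identity under `σ`. -/
def kernel (ε : Encoding G Q) : Subgroup (MajoranaGroup G) := cycleGroup G ⊓ ε.σ.ker

/-- The stabilizer group is finite; so its rank (least number of generators) makes sense. -/
instance finite_stabilizer (ε : Encoding G Q) : Finite ε.stabilizer := by
  have hfin : (Set.range fun p : ZMod 4 × (Q → Pauli) => iPow p.1 • pauliString p.2).Finite :=
    Set.finite_range _
  have hpre : ((fun u : (QubitOp Q)ˣ => (u : QubitOp Q)) ⁻¹'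
      (Set.range fun p : ZMod 4 × (Q → Pauli) => iPow p.1 • pauliString p.2)).Finite :=
    hfin.preimage (Units.val_injective.injOn)
  refine (hpre.subset ?_).to_subtype
  rintro u ⟨m, -, rfl⟩
  obtain ⟨k, P, h⟩ := ε.isPauliOp m
  exact ⟨(k, P), h.symm⟩

/-- The disparity `Δ = N - M - D(S)`, where `N` is the number of qubits, `M` the number of modes
(vertices), and `D(S)` the least number of generators of the stabilizer group. -/
noncomputable def disparity [Fintype V] (ε : Encoding G Q) : ℤ :=
  (Fintype.card Q : ℤ) - Fintype.card V - Group.rank ε.stabilizer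

end Encoding

/-! ### Plane embeddings -/

/-- The face permutation of a rotation `rot` of the darts: go along the dart `d`, and leave its
endpoint along the dart that follows the reverse of `d` in the rotation at that vertex. -/
def facePerm {V : Type*} {G : SimpleGraph V} (rot : Equiv.Perm G.Dart) : Equiv.Perm G.Dart :=
  (SimpleGraph.Dart.symm_involutive (G := G)).toPerm.trans rot

/-- The faces of a rotation system: the orbits of the face permutation. A dart belongs to the orbit
of the face lying on a fixed side of it; its reverse belongs to the face on the other side. -/
def FaceOf {V : Type*} {G : SimpleGraph V} (rot : Equiv.Perm G.Dart) : Type _ :=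
  Quotient (Equiv.Perm.SameCycle.setoid (facePerm rot))

/-- The face on the fixed side of the dart `d`. -/
def faceOf {V : Type*} {G : SimpleGraph V} (rot : Equiv.Perm G.Dart) (d : G.Dart) : FaceOf rot :=
  Quotient.mk (Equiv.Perm.SameCycle.setoid (facePerm rot)) d

/-- A plane embedding of a connected graph, as a combinatorial map of genus zero: the cyclic order
`rot` of the darts leaving each vertex, and a choice of the unbounded face, such that Euler's formula
`|V| - |E| + |F| = 2` holds. A graph without edges (a single vertex) has only the unbounded face,
which has no darts around it; hence `F` is counted as the bounded faces plus one. -/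
structure PlaneEmbedding {V : Type*} [Fintype V] (G : SimpleGraph V) where
  rot : Equiv.Perm G.Dart
  fst_rot : ∀ d, (rot d).fst = d.fst
  sameCycle_rot : ∀ d d' : G.Dart, d.fst = d'.fst → rot.SameCycle d d'
  IsUnbounded : FaceOf rot → Prop
  existsUnique_isUnbounded : Nonempty G.Dart → ∃! f, IsUnbounded f
  euler : (Fintype.card V : ℤ) - Nat.card G.edgeSet + (Nat.card {f // ¬ IsUnbounded f} + 1) = 2

namespace PlaneEmbedding

variable {V : Type*} [Fintype V] {G : SimpleGraph V}

/-- The bounded faces; "face" means bounded face in what follows. -/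
def Face (Λ : PlaneEmbedding G) : Type _ := {f : FaceOf Λ.rot // ¬ Λ.IsUnbounded f}

/-- The face `f` lies on the fixed side of the dart `d`. -/
def Beside (Λ : PlaneEmbedding G) (d : G.Dart) (f : Λ.Face) : Prop := faceOf Λ.rot d = f.1

/-- The (undirected) edge of the dart `d` is adjacent to the face `f`. -/
def Adjacent (Λ : PlaneEmbedding G) (d : G.Dart) (f : Λ.Face) : Prop :=
  Λ.Beside d f ∨ Λ.Beside d.symm f

/-- The closed boundary walk of the face containing `d` on its fixed side, started at `d`. -/
noncomputable def boundaryWalk (Λ : PlaneEmbedding G) (d : G.Dart) : List G.Dart :=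
  (List.range (Function.minimalPeriod (facePerm Λ.rot) d)).map fun k => (facePerm Λ.rot)^[k] d

/-- The face cycle of `f`: the element of the cycle group given by the closed boundary walk of `f`.
(The starting point is immaterial, as the elements of the cycle group are central.) -/
noncomputable def faceCycle (Λ : PlaneEmbedding G) (f : Λ.Face) : MajoranaGroup G :=
  pathElt (Λ.boundaryWalk (Quotient.out f.1))

/-- The face `f` is bounded by a cycle: the edges with `f` on exactly one side are exactly the edges
of a simple cycle of `G`. -/
def BoundedByCycle (Λ : PlaneEmbedding G) (f : Λ.Face) : Prop :=
  ∃ (v : V) (p : G.Walk v v), p.IsCycle ∧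
    ∀ d : G.Dart, d.edge ∈ p.edges ↔ Xor (Λ.Beside d f) (Λ.Beside d.symm f)

end PlaneEmbedding

/-! ### Weight 3 planar encodings -/

/-- A Weight 3 planar encoding on the plane graph `Λ`, with auxiliary qubits `A`. The qubits are one
vertex qubit `Sum.inl v` for every vertex `v` and the auxiliary qubits `Sum.inr a`. Operators are
prescribed up to a phase. -/
structure Weight3PlanarEncoding {V : Type*} [Fintype V] [DecidableEq V] {G : SimpleGraph V}
    (Λ : PlaneEmbedding G) (A : Type*) [Fintype A] [DecidableEq A]
    extends Encoding G (V ⊕ A) where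
  /-- Every auxiliary qubit is associated with a unique face. -/
  face : A → Λ.Face
  /-- Every face is associated with at most one auxiliary qubit. -/
  face_injective : Function.Injective face
  /-- Every vertex operator is a Pauli `Z` on the vertex qubit. -/
  vertex_op : ∀ v : V, ∃ (k : ZMod 4) (P : V ⊕ A → Pauli),
    (σ (gen (.vertex v)) : QubitOp (V ⊕ A)) = iPow k • pauliString P ∧
    P (.inl v) = .Z ∧ ∀ q, q ≠ .inl v → P q = .I
  /-- Every edge operator is an `X` or `Y` on each of the two incident vertex qubits, and a
  non-identity Pauli on at most one auxiliary qubit, whose face is adjacent to the edge. -/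
  edge_op : ∀ d : G.Dart, ∃ (k : ZMod 4) (P : V ⊕ A → Pauli),
    (σ (gen (.edge d)) : QubitOp (V ⊕ A)) = iPow k • pauliString P ∧
    (P (.inl d.fst) = .X ∨ P (.inl d.fst) = .Y) ∧
    (P (.inl d.snd) = .X ∨ P (.inl d.snd) = .Y) ∧
    (∀ v, v ≠ d.fst → v ≠ d.snd → P (.inl v) = .I) ∧
    (∀ a, P (.inr a) ≠ .I → Λ.Adjacent d (face a)) ∧
    (∀ a b, P (.inr a) ≠ .I → P (.inr b) ≠ .I → a = b)

namespace Weight3PlanarEncoding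

variable {V : Type*} [Fintype V] [DecidableEq V] {G : SimpleGraph V} {Λ : PlaneEmbedding G}
  {A : Type*} [Fintype A] [DecidableEq A]

/-- `F_K`, the number of faces whose face cycle lies in `K`. -/
noncomputable def numFaceCyclesInKernel (ε : Weight3PlanarEncoding Λ A) : ℕ :=
  Nat.card {f : Λ.Face // Λ.faceCycle f ∈ ε.kernel}

/-- `EF`, the number of faces without an auxiliary qubit. -/
noncomputable def numEmptyFaces (ε : Weight3PlanarEncoding Λ A) : ℕ :=
  Nat.card {f : Λ.Face // f ∉ Set.range ε.face}

end Weight3PlanarEncoding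

end FermionicEncoding

/-!
Up to phases, Pauli operators are vectors over `ZMod 2`, multiplication being addition. Since `-1`
is not in `S`, no two elements of `S` differ by a phase, so `S` is the image of the mod 2 cycle
space of `G` under the linear map `chainLabel` taking a sum of edges to the label of their product,
and `D(S)` is the dimension of that image.

By Euler's formula the boundaries of the bounded faces form a basis of the cycle space, of
dimension `|F|`. Let `c` be a chain with trivial label. Two of its edges that carry the same letter
(`X` or `Y`) on a common vertex qubit have to anticommute, hence share their auxiliary qubit. So
the letters cancel separately within the part of `c` acting on a given auxiliary qubit, and that
part has trivial label as well. It is a cycle supported on the simple cycle bounding the face of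
the qubit, hence `0` or the whole boundary of that face. Therefore the kernel of `chainLabel` is
spanned by the face boundaries that it contains and has dimension `F_K`. So `D(S) = |F| - F_K`,
whereas `N - M = |F| - EF`.
-/

namespace FermionicEncoding

section Phases

theorem iPow_add (a b : ZMod 4) : iPow (a + b) = iPow a * iPow b := by
  rw [iPow, iPow, iPow, ← pow_add, ZMod.val_add, ← Complex.I_pow_eq_pow_mod]

theorem iPow_zero : iPow 0 = 1 := pow_zero _

theorem iPow_one : iPow 1 = Complex.I := pow_one _

theorem iPow_two : iPow 2 = -1 := Complex.I_sq

theorem iPow_three : iPow 3 = -Complex.I := Complex.I_pow_three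

theorem iPow_ne_zero (k : ZMod 4) : iPow k ≠ 0 := pow_ne_zero _ Complex.I_ne_zero

theorem iPow_sum {ι : Type*} (s : Finset ι) (k : ι → ZMod 4) :
    iPow (∑ i ∈ s, k i) = ∏ i ∈ s, iPow (k i) := by
  classical
  induction s using Finset.induction_on with
  | empty => exact iPow_zero
  | insert a s ha ih => rw [Finset.sum_insert ha, Finset.prod_insert ha, iPow_add, ih]

end Phases

namespace Pauli

/-- The symplectic coordinates `(x, z)` of a Pauli operator, which is `X ^ x * Z ^ z` up to a phase.
They turn products of Pauli operators into sums. -/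
def vec : Pauli → ZMod 2 × ZMod 2
  | I => (0, 0)
  | X => (1, 0)
  | Y => (1, 1)
  | Z => (0, 1)

theorem vec_injective : Function.Injective vec := by
  intro p q; cases p <;> cases q <;> decide

theorem vec_eq_zero_iff {p : Pauli} : p.vec = 0 ↔ p = I :=
  vec_injective.eq_iff' rfl

theorem mat_mul_self (p : Pauli) : p.mat * p.mat = 1 := by
  cases p <;> simp [mat, Matrix.one_fin_two]

theorem mat_mul_mat : ∀ p q : Pauli,
    ∃ (k : ZMod 4) (r : Pauli), p.mat * q.mat = iPow k • r.mat ∧ r.vec = p.vec + q.vec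
  | I, q => ⟨0, q, by simp [mat, iPow_zero], by simp [vec]⟩
  | p, I => ⟨0, p, by simp [mat, iPow_zero], by simp [vec]⟩
  | X, X => ⟨0, I, by rw [mat_mul_self, iPow_zero, one_smul, mat], rfl⟩
  | Y, Y => ⟨0, I, by rw [mat_mul_self, iPow_zero, one_smul, mat], rfl⟩
  | Z, Z => ⟨0, I, by rw [mat_mul_self, iPow_zero, one_smul, mat], rfl⟩
  | X, Y => ⟨1, Z, by simp [mat, iPow_one], rfl⟩
  | Y, X => ⟨3, Z, by simp [mat, iPow_three], rfl⟩
  | Y, Z => ⟨1, X, by simp [mat, iPow_one], rfl⟩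
  | Z, Y => ⟨3, X, by simp [mat, iPow_three], rfl⟩
  | Z, X => ⟨1, Y, by simp [mat, iPow_one], rfl⟩
  | X, Z => ⟨3, Y, by simp [mat, iPow_three], rfl⟩

theorem trace_mat_mul_mat_of_ne {p q : Pauli} (h : p ≠ q) : (p.mat * q.mat).trace = 0 := by
  cases p <;> cases q <;> simp_all [mat, Matrix.trace_fin_two]

end Pauli

section Tensor

variable {Q : Type*}

/-- The coordinates `Pauli.vec` of the tensor factors of a multi-qubit Pauli operator. -/
abbrev PauliVec (Q : Type*) : Type _ := Q → ZMod 2 × ZMod 2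

variable [Fintype Q]

/-- The tensor product over all qubits of a family of single-qubit operators. -/
def qubitTensor (A : Q → Matrix (Fin 2) (Fin 2) ℂ) : QubitOp Q :=
  Matrix.of fun x y => ∏ q, A q (x q) (y q)

theorem pauliString_eq_qubitTensor (P : Q → Pauli) :
    pauliString P = qubitTensor fun q => (P q).mat := rfl

theorem qubitTensor_one : qubitTensor (1 : Q → Matrix (Fin 2) (Fin 2) ℂ) = 1 := by
  ext x y
  simp only [qubitTensor, Matrix.of_apply, Pi.one_apply, Matrix.one_apply, Fintype.prod_ite_zero,
    Finset.prod_const_one, funext_iff]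

theorem pauliString_one : pauliString (fun _ : Q => Pauli.I) = 1 := qubitTensor_one

theorem qubitTensor_smul (s : Q → ℂ) (A : Q → Matrix (Fin 2) (Fin 2) ℂ) :
    qubitTensor (fun q => s q • A q) = (∏ q, s q) • qubitTensor A := by
  ext x y
  simp [qubitTensor, Finset.prod_mul_distrib]

variable [DecidableEq Q]

theorem qubitTensor_mul (A B : Q → Matrix (Fin 2) (Fin 2) ℂ) :
    qubitTensor A * qubitTensor B = qubitTensor fun q => A q * B q := by
  ext x y
  simp only [qubitTensor, Matrix.mul_apply, Matrix.of_apply, ← Finset.prod_mul_distrib]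
  rw [Finset.prod_univ_sum, Fintype.piFinset_univ]

theorem trace_qubitTensor (A : Q → Matrix (Fin 2) (Fin 2) ℂ) :
    (qubitTensor A).trace = ∏ q, (A q).trace := by
  simp only [qubitTensor, Matrix.trace, Matrix.diag, Matrix.of_apply]
  rw [Finset.prod_univ_sum, Fintype.piFinset_univ]

theorem pauliString_mul (P R : Q → Pauli) : ∃ (k : ZMod 4) (T : Q → Pauli),
    pauliString P * pauliString R = iPow k • pauliString T ∧
      ∀ q, (T q).vec = (P q).vec + (R q).vec := by
  choose k T hmat hvec using fun q => (P q).mat_mul_mat (R q)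
  refine ⟨∑ q, k q, T, ?_, hvec⟩
  simp only [pauliString_eq_qubitTensor, qubitTensor_mul, hmat, qubitTensor_smul, iPow_sum]

theorem pauliString_mul_self (P : Q → Pauli) : pauliString P * pauliString P = 1 := by
  simp only [pauliString_eq_qubitTensor, qubitTensor_mul, Pauli.mat_mul_self]
  exact qubitTensor_one

theorem trace_pauliString_mul_of_ne {P R : Q → Pauli} (h : P ≠ R) :
    (pauliString P * pauliString R).trace = 0 := by
  obtain ⟨q, hq⟩ := Function.ne_iff.1 h
  rw [pauliString_eq_qubitTensor, pauliString_eq_qubitTensor, qubitTensor_mul, trace_qubitTensor]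
  exact Finset.prod_eq_zero (Finset.mem_univ q) (Pauli.trace_mat_mul_mat_of_ne hq)

theorem commute_pauliString {P R : Q → Pauli} (h : ∀ q, P q = .I ∨ R q = .I ∨ P q = R q) :
    Commute (pauliString P) (pauliString R) := by
  simp only [Commute, SemiconjBy, pauliString_eq_qubitTensor, qubitTensor_mul]
  congr 1
  funext q
  rcases h q with hq | hq | hq <;> simp [hq, Pauli.mat]

end Tensor

section PauliLabel

variable {Q : Type*} [Fintype Q]

theorem eq_of_smul_pauliString_eq {a b : ℂ} (hb : b ≠ 0) {P R : Q → Pauli}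
    (h : a • pauliString P = b • pauliString R) : P = R := by
  classical
  by_contra hPR
  have htrace := congrArg (fun U => (U * pauliString R).trace) h
  simp only [smul_mul_assoc, pauliString_mul_self, Matrix.trace_smul,
    trace_pauliString_mul_of_ne hPR, Matrix.trace_one] at htrace
  simp [hb] at htrace

/-- The symplectic coordinates of a Pauli operator; operators outside the Pauli group get the junk
value `0`. -/
noncomputable def pauliLabel : QubitOp Q → PauliVec Q :=
  Function.extend (fun kP : ZMod 4 × (Q → Pauli) => iPow kP.1 • pauliString kP.2)
    (fun kP q => (kP.2 q).vec) 0

theorem pauliLabel_smul_pauliString (k : ZMod 4) (P : Q → Pauli) :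
    pauliLabel (iPow k • pauliString P) = fun q => (P q).vec := by
  have hfactors : Function.FactorsThrough (fun kP : ZMod 4 × (Q → Pauli) => fun q => (kP.2 q).vec)
      fun kP => iPow kP.1 • pauliString kP.2 := fun kP lR h =>
    congrArg (fun P q => (P q).vec) (eq_of_smul_pauliString_eq (iPow_ne_zero lR.1) h)
  exact hfactors.extend_apply 0 (k, P)

theorem pauliLabel_iPow_smul_one (k : ZMod 4) : pauliLabel (iPow k • (1 : QubitOp Q)) = 0 := by
  rw [← pauliString_one, pauliLabel_smul_pauliString]
  rfl

namespace IsPauliOp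

variable {U U' : QubitOp Q}

theorem exists_eq_smul_one (h : IsPauliOp U) (h0 : pauliLabel U = 0) :
    ∃ k : ZMod 4, U = iPow k • 1 := by
  obtain ⟨k, P, rfl⟩ := h
  rw [pauliLabel_smul_pauliString] at h0
  have hP : P = fun _ => .I := funext fun q => Pauli.vec_eq_zero_iff.1 (congrFun h0 q)
  exact ⟨k, by rw [hP, pauliString_one]⟩

variable [DecidableEq Q]

theorem pauliLabel_mul (h : IsPauliOp U) (h' : IsPauliOp U') :
    pauliLabel (U * U') = pauliLabel U + pauliLabel U' := by
  obtain ⟨k, P, rfl⟩ := h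
  obtain ⟨l, R, rfl⟩ := h'
  obtain ⟨m, T, hT, hvec⟩ := pauliString_mul P R
  rw [smul_mul_smul_comm, hT, smul_smul, ← iPow_add, ← iPow_add]
  simp only [pauliLabel_smul_pauliString]
  exact funext hvec

theorem commute_of_pauliLabel (h : IsPauliOp U) (h' : IsPauliOp U')
    (hlabel : ∀ q, pauliLabel U q = 0 ∨ pauliLabel U' q = 0 ∨ pauliLabel U q = pauliLabel U' q) :
    Commute U U' := by
  obtain ⟨k, P, rfl⟩ := h
  obtain ⟨l, R, rfl⟩ := h'
  simp only [pauliLabel_smul_pauliString, Pauli.vec_eq_zero_iff,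
    Pauli.vec_injective.eq_iff] at hlabel
  exact ((commute_pauliString hlabel).smul_left _).smul_right _

end IsPauliOp

end PauliLabel

section ElementaryAbelian

variable {p : ℕ} {W : Type*} [AddCommGroup W] [Module (ZMod p) W]

theorem toZModSubmodule_closure (s : Set W) :
    AddSubgroup.toZModSubmodule p (AddSubgroup.closure s) = Submodule.span (ZMod p) s :=
  le_antisymm
    ((AddSubgroup.toZModSubmodule p).le_symm_apply.1
      ((AddSubgroup.closure_le _).2 Submodule.subset_span))
    (Submodule.span_le.2 AddSubgroup.subset_closure)

theorem closure_eq_top_iff_span_eq_top (p : ℕ) [Module (ZMod p) W] (T : Set (Multiplicative W)) :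
    Subgroup.closure T = ⊤ ↔ Submodule.span (ZMod p) (Multiplicative.toAdd '' T) = ⊤ := by
  rw [← toZModSubmodule_closure, map_eq_top_iff, Multiplicative.toAdd.image_eq_preimage_symm,
    Multiplicative.toAdd_symm_eq, ← Subgroup.toAddSubgroup'_closure, map_eq_top_iff]

theorem rank_multiplicative_eq_finrank [Fact p.Prime] [Module.Finite (ZMod p) W]
    [Group.FG (Multiplicative W)] :
    Group.rank (Multiplicative W) = Module.finrank (ZMod p) W := by
  classical
  apply le_antisymm
  · let b := Module.finBasis (ZMod p) W
    let T : Finset (Multiplicative W) := Finset.univ.image (Multiplicative.ofAdd ∘ b)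
    have hT : Subgroup.closure (T : Set (Multiplicative W)) = ⊤ := by
      rw [closure_eq_top_iff_span_eq_top p, ← b.span_eq]
      simp only [T, Finset.coe_image, Finset.coe_univ, Set.image_univ, ← Set.range_comp]
      rfl
    calc Group.rank (Multiplicative W) ≤ T.card := Group.rank_le hT
      _ ≤ Module.finrank (ZMod p) W := Finset.card_image_le.trans_eq (Finset.card_fin _)
  · obtain ⟨T, hcard, hT⟩ := Group.rank_spec (Multiplicative W)
    rw [closure_eq_top_iff_span_eq_top p, ← Finset.coe_image] at hT
    calc Module.finrank (ZMod p) W ≤ (T.image Multiplicative.toAdd).card := by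
          rw [← finrank_top, ← hT]
          exact finrank_span_finset_le_card _
      _ ≤ Group.rank (Multiplicative W) := Finset.card_image_le.trans_eq hcard

end ElementaryAbelian

theorem sum_smul_eq_zero_iff {ι : Type*} [Fintype ι] {x : ι → ZMod 2 × ZMod 2}
    (hx : ∀ i, x i ≠ (0, 1)) (u : ι → ZMod 2) :
    ∑ i, u i • x i = 0 ↔ ∀ l ≠ 0, ∑ i with x i = l, u i = 0 := by
  have hfiber : ∑ i, u i • x i = ∑ l, (∑ i with x i = l, u i) • l := by
    rw [← Finset.sum_fiberwise _ x]
    refine Finset.sum_congr rfl fun l _ => ?_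
    rw [Finset.sum_smul]
    exact Finset.sum_congr rfl fun i hi => by rw [(Finset.mem_filter.1 hi).2]
  have hcases : ∀ l : ZMod 2 × ZMod 2, l ≠ 0 → l = (1, 0) ∨ l = (1, 1) ∨ l = (0, 1) := by decide
  have h01 : ∑ i with x i = (0, 1), u i = 0 := by simp [hx]
  constructor
  · intro h l hl
    have hsum : (∑ i with x i = (1, 0), u i) • ((1, 0) : ZMod 2 × ZMod 2) +
        (∑ i with x i = (1, 1), u i) • ((1, 1) : ZMod 2 × ZMod 2) = 0 := by
      rw [← h, hfiber, show (Finset.univ : Finset (ZMod 2 × ZMod 2)) =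
        {0, (1, 0), (1, 1), (0, 1)} by decide]
      simp [h01]
    obtain ⟨h1, h2⟩ := Prod.ext_iff.1 hsum
    have h11 : ∑ i with x i = (1, 1), u i = 0 := by simpa using h2
    have h10 : ∑ i with x i = (1, 0), u i = 0 := by simpa [h11] using h1
    rcases hcases l hl with rfl | rfl | rfl
    exacts [h10, h11, h01]
  · intro h
    rw [hfiber]
    refine Finset.sum_eq_zero fun l _ => ?_
    by_cases hl : l = 0
    · rw [hl, smul_zero]
    · rw [h l hl, zero_smul]

section Chains

variable {V : Type*} {G : SimpleGraph V}

/-- The undirected edge of a dart, as a member of the edge set that indexes mod 2 chains. -/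
def dartEdge (d : G.Dart) : G.edgeSet := ⟨d.edge, d.edge_mem⟩

theorem dartEdge_surjective : Function.Surjective (dartEdge : G.Dart → G.edgeSet) := by
  rintro ⟨e, he⟩
  induction e with
  | _ x y => exact ⟨⟨(x, y), he⟩, rfl⟩

theorem dartEdge_symm (d : G.Dart) : dartEdge d.symm = dartEdge d :=
  Subtype.ext d.edge_symm

theorem dartEdge_eq_iff {d d' : G.Dart} : dartEdge d = dartEdge d' ↔ d = d' ∨ d = d'.symm :=
  Subtype.ext_iff.trans (SimpleGraph.dart_edge_eq_iff d d')

theorem mem_dartEdge {d : G.Dart} {v : V} : v ∈ (dartEdge d).1 ↔ v = d.fst ∨ v = d.snd :=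
  Sym2.mem_iff

theorem exists_dart_snd_eq {e : G.edgeSet} {v : V} (hv : v ∈ e.1) :
    ∃ d, dartEdge d = e ∧ d.snd = v := by
  obtain ⟨d, rfl⟩ := dartEdge_surjective e
  rcases mem_dartEdge.1 hv with rfl | rfl
  exacts [⟨d.symm, dartEdge_symm d, rfl⟩, ⟨d, rfl, rfl⟩]

variable [DecidableEq V]

/-- The mod 2 edge chain of a dart. -/
def dartChain (d : G.Dart) : G.edgeSet → ZMod 2 := Pi.single (dartEdge d) 1

/-- The mod 2 edge chain of a list of darts, which counts the passages along every edge in either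
direction. -/
def listChain (l : List G.Dart) : G.edgeSet → ZMod 2 := (l.map dartChain).sum

theorem listChain_nil : listChain ([] : List G.Dart) = 0 := rfl

theorem listChain_cons (d : G.Dart) (l : List G.Dart) :
    listChain (d :: l) = dartChain d + listChain l := by
  rw [listChain, List.map_cons, List.sum_cons, listChain]

theorem dartChain_dartEdge (d d' : G.Dart) : dartChain d' (dartEdge d) =
    (if d' = d then 1 else 0) + if d' = d.symm then 1 else 0 := by
  simp only [dartChain, Pi.single_apply, eq_comm (a := dartEdge d), dartEdge_eq_iff]
  by_cases h : d' = d
  · simp [h, d.symm_ne.symm]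
  · simp [h]

theorem listChain_dartEdge (l : List G.Dart) (d : G.Dart) :
    listChain l (dartEdge d) = l.count d + l.count d.symm := by
  induction l with
  | nil => simp [listChain_nil]
  | cons d' l ih =>
    rw [listChain_cons, Pi.add_apply, ih, dartChain_dartEdge, List.count_cons, List.count_cons]
    simp only [beq_iff_eq, Nat.cast_add, Nat.cast_ite, Nat.cast_one, Nat.cast_zero]
    abel

variable [Fintype G.edgeSet]

/-- The mod 2 boundary map from edge chains to vertex chains. -/
def bdry (G : SimpleGraph V) [Fintype G.edgeSet] :
    (G.edgeSet → ZMod 2) →ₗ[ZMod 2] (V → ZMod 2) :=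
  Fintype.linearCombination (ZMod 2) fun e v => if v ∈ e.1 then 1 else 0

theorem bdry_apply (u : G.edgeSet → ZMod 2) (v : V) : bdry G u v = ∑ e with v ∈ e.1, u e := by
  simp [bdry, Fintype.linearCombination_apply, Finset.sum_filter]

theorem bdry_dartChain (d : G.Dart) :
    bdry G (dartChain d) = Pi.single d.fst 1 + Pi.single d.snd 1 := by
  rw [bdry, dartChain, Fintype.linearCombination_apply_single, one_smul]
  funext v
  simp only [mem_dartEdge, Pi.add_apply, Pi.single_apply]
  by_cases h : v = d.fst
  · simp [h, d.fst_ne_snd]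
  · simp [h]

theorem bdry_listChain_darts {u v : V} (w : G.Walk u v) :
    bdry G (listChain w.darts) = Pi.single u 1 + Pi.single v 1 := by
  induction w with
  | nil => rw [SimpleGraph.Walk.darts_nil, listChain_nil, map_zero, ZModModule.add_self]
  | @cons a b c h p ih =>
    rw [SimpleGraph.Walk.darts_cons, listChain_cons, map_add, bdry_dartChain, ih, add_assoc,
      ← add_assoc (Pi.single b 1), ZModModule.add_self, zero_add]

theorem range_bdry_sup_span_single (hG : G.Connected) (v₀ : V) [Finite V] :
    LinearMap.range (bdry G) ⊔ Submodule.span (ZMod 2) {Pi.single v₀ 1} = ⊤ := by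
  rw [eq_top_iff, ← (Pi.basisFun (ZMod 2) V).span_eq, Submodule.span_le]
  rintro _ ⟨v, rfl⟩
  obtain ⟨w⟩ := hG.preconnected v v₀
  rw [Pi.basisFun_apply]
  refine Submodule.mem_sup.2 ⟨_, ⟨listChain w.darts, rfl⟩, _,
    Submodule.mem_span_singleton_self _, ?_⟩
  rw [bdry_listChain_darts, add_assoc, ZModModule.add_self, add_zero]

theorem finrank_ker_bdry_add_card_le [Fintype V] (hG : G.Connected) :
    Module.finrank (ZMod 2) (LinearMap.ker (bdry G)) + Fintype.card V ≤
      Fintype.card G.edgeSet + 1 := by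
  obtain ⟨v₀⟩ := hG.nonempty
  have hrank_nullity := (bdry G).finrank_range_add_finrank_ker
  have hsup := Submodule.finrank_add_le_finrank_add_finrank (LinearMap.range (bdry G))
    (Submodule.span (ZMod 2) {(Pi.single v₀ 1 : V → ZMod 2)})
  have hline := finrank_span_singleton (K := ZMod 2)
    (Pi.single_ne_zero_iff.2 one_ne_zero : (Pi.single v₀ 1 : V → ZMod 2) ≠ 0)
  rw [Module.finrank_fintype_fun_eq_card] at hrank_nullity
  rw [range_bdry_sup_span_single hG, finrank_top, Module.finrank_fintype_fun_eq_card] at hsup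
  lia

/-- `u` has no boundary at the first vertex of the path, so it vanishes on the first edge. -/
theorem eq_zero_of_support_subset_path {a b : V} {p : G.Walk a b} (hp : p.IsPath)
    {u : G.edgeSet → ZMod 2} (hu : ∀ e, u e ≠ 0 → e.1 ∈ p.edges) (hbdry : bdry G u = 0) :
    u = 0 := by
  induction p with
  | nil => exact funext fun e => by_contra fun h => by simpa using hu e h
  | @cons a b c h p ih =>
    obtain ⟨hp, ha⟩ := (SimpleGraph.Walk.cons_isPath_iff h p).1 hp
    simp only [SimpleGraph.Walk.edges_cons, List.mem_cons] at hu
    let e₀ : G.edgeSet := dartEdge ⟨(a, b), h⟩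
    have hfirst : ∀ e, u e ≠ 0 → a ∈ e.1 → e = e₀ := fun e he hae =>
      Subtype.ext ((hu e he).resolve_right fun hep => ha (p.mem_support_of_mem_edges hep hae))
    have hzero : u e₀ = 0 := by
      have hbdry_a : ∑ e with a ∈ e.1, u e = 0 := by rw [← bdry_apply, hbdry, Pi.zero_apply]
      have ha₀ : e₀ ∈ ({e | a ∈ e.1} : Finset G.edgeSet) := by simp [e₀, mem_dartEdge]
      rw [← hbdry_a, Finset.sum_eq_single_of_mem e₀ ha₀ fun e hae he => ?_]
      exact not_not.1 fun hue => he (hfirst e hue (Finset.mem_filter.1 hae).2)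
    exact ih hp fun e he => (hu e he).resolve_left fun heq =>
      he ((congrArg u (Subtype.ext heq : e = e₀)).trans hzero)

theorem exists_eq_smul_of_support_subset_cycle {a : V} {p : G.Walk a a} (hp : p.IsCycle)
    {u b : G.edgeSet → ZMod 2} (hu : ∀ e, u e ≠ 0 → e.1 ∈ p.edges)
    (hb : ∀ e, b e ≠ 0 ↔ e.1 ∈ p.edges) (hu_bdry : bdry G u = 0) (hb_bdry : bdry G b = 0) :
    ∃ s : ZMod 2, u = s • b := by
  cases p with
  | nil => exact absurd hp (by simp)
  | @cons a v c h p =>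
    let e₀ : G.edgeSet := dartEdge ⟨(a, v), h⟩
    have hb₀ : b e₀ = 1 := Fin.eq_one_of_ne_zero _ ((hb e₀).2 (by simp [e₀, dartEdge]))
    have hp : p.IsPath := ((SimpleGraph.Walk.cons_isCycle_iff p h).1 hp).1
    refine ⟨u e₀, sub_eq_zero.1 (eq_zero_of_support_subset_path hp (fun e he => ?_) ?_)⟩
    · have he₀ : e.1 ≠ s(a, v) := by
        intro heq
        obtain rfl : e = e₀ := Subtype.ext heq
        simp [hb₀] at he
      have hmem : e.1 ∈ (SimpleGraph.Walk.cons h p).edges := by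
        by_contra hn
        simp [not_not.1 (mt (hu e) hn), not_not.1 (mt (hb e).1 hn)] at he
      exact (List.mem_cons.1 hmem).resolve_left he₀
    · rw [map_sub, map_smul, hu_bdry, hb_bdry, smul_zero, sub_zero]

end Chains

section Faces

variable {V : Type*} {G : SimpleGraph V}

theorem facePerm_apply (rot : Equiv.Perm G.Dart) (d : G.Dart) : facePerm rot d = rot d.symm := rfl

theorem faceOf_eq_iff {rot : Equiv.Perm G.Dart} {d d' : G.Dart} :
    faceOf rot d = faceOf rot d' ↔ (facePerm rot).SameCycle d d' :=
  Quotient.eq (r := Equiv.Perm.SameCycle.setoid (facePerm rot))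

theorem faceOf_surjective (rot : Equiv.Perm G.Dart) : Function.Surjective (faceOf rot) :=
  Quotient.exists_rep

theorem faceOf_out {rot : Equiv.Perm G.Dart} (f : FaceOf rot) :
    faceOf rot (Quotient.out f) = f :=
  Quotient.out_eq f

theorem faceOf_rot (rot : Equiv.Perm G.Dart) (d : G.Dart) :
    faceOf rot (rot d) = faceOf rot d.symm :=
  faceOf_eq_iff.2 (Equiv.Perm.sameCycle_apply_left (f := facePerm rot) (x := d.symm).2 .rfl)

instance finite_dart [Finite V] : Finite G.Dart :=
  Finite.of_injective _ SimpleGraph.Dart.toProd_injective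

instance finite_faceOf [Finite V] (rot : Equiv.Perm G.Dart) : Finite (FaceOf rot) :=
  Quotient.finite _

namespace PlaneEmbedding

variable [Fintype V] (Λ : PlaneEmbedding G)

instance finite_face : Finite Λ.Face := Subtype.finite

theorem exists_walk_darts_eq_iterate (d : G.Dart) (n : ℕ) :
    ∃ w : G.Walk d.fst ((facePerm Λ.rot)^[n] d).fst,
      w.darts = (List.range n).map fun k => (facePerm Λ.rot)^[k] d := by
  induction n with
  | zero => exact ⟨.nil, rfl⟩
  | succ n ih =>
    obtain ⟨w, hw⟩ := ih
    have hfst : ((facePerm Λ.rot)^[n + 1] d).fst = ((facePerm Λ.rot)^[n] d).snd := by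
      rw [Function.iterate_succ_apply', facePerm_apply, Λ.fst_rot, SimpleGraph.Dart.symm_toProd,
        Prod.fst_swap]
    rw [hfst]
    refine ⟨w.concat ((facePerm Λ.rot)^[n] d).adj, ?_⟩
    rw [SimpleGraph.Walk.darts_concat, hw, List.range_succ, List.map_append, List.concat_eq_append,
      List.map_singleton]

theorem exists_walk_darts_eq_boundaryWalk (d : G.Dart) :
    ∃ w : G.Walk d.fst d.fst, w.darts = Λ.boundaryWalk d := by
  have h := Λ.exists_walk_darts_eq_iterate d (Function.minimalPeriod (facePerm Λ.rot) d)
  rwa [Function.iterate_minimalPeriod] at h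

theorem nodup_boundaryWalk (d : G.Dart) : (Λ.boundaryWalk d).Nodup :=
  List.nodup_range.map_on fun _ hx _ hy h => Function.iterate_injOn_Iio_minimalPeriod
    (List.mem_range.1 hx) (List.mem_range.1 hy) h

theorem mem_boundaryWalk {d d' : G.Dart} :
    d' ∈ Λ.boundaryWalk d ↔ faceOf Λ.rot d' = faceOf Λ.rot d := by
  rw [eq_comm, faceOf_eq_iff, boundaryWalk, List.mem_map]
  constructor
  · rintro ⟨k, -, rfl⟩
    exact ⟨k, by rw [zpow_natCast, Equiv.Perm.iterate_eq_pow]⟩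
  · intro h
    obtain ⟨k, rfl⟩ := h.exists_nat_pow_eq
    have hpos : 0 < Function.minimalPeriod (facePerm Λ.rot) d :=
      Function.minimalPeriod_pos_of_mem_periodicPts
        ((facePerm Λ.rot).injective.mem_periodicPts d)
    refine ⟨k % Function.minimalPeriod (facePerm Λ.rot) d, List.mem_range.2 (k.mod_lt hpos), ?_⟩
    rw [Function.iterate_mod_minimalPeriod_eq, Equiv.Perm.iterate_eq_pow]

theorem eq_of_fst_eq {α : Type*} {x : G.Dart → α} (hrot : ∀ d, x (Λ.rot d) = x d)
    {d d' : G.Dart} (h : d.fst = d'.fst) : x d = x d' := by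
  obtain ⟨n, rfl⟩ := (Λ.sameCycle_rot d d' h).exists_nat_pow_eq
  have hsemiconj : Function.Semiconj x Λ.rot id := hrot
  rw [← Equiv.Perm.iterate_eq_pow, (hsemiconj.iterate_right n).eq, Function.iterate_id, id]

theorem eq_of_connected (hG : G.Connected) {α : Type*} {x : G.Dart → α}
    (hsymm : ∀ d, x d.symm = x d) (hrot : ∀ d, x (Λ.rot d) = x d) (d d' : G.Dart) :
    x d = x d' := by
  have hwalk : ∀ {a b : V}, G.Walk a b → ∀ d d' : G.Dart, d.fst = a → d'.fst = b → x d = x d' := by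
    intro a b w
    induction w with
    | nil => exact fun d d' hd hd' => Λ.eq_of_fst_eq hrot (hd.trans hd'.symm)
    | @cons a b c hab _ ih =>
      intro d d' hd hd'
      calc x d = x ⟨(a, b), hab⟩ := Λ.eq_of_fst_eq hrot hd
        _ = x (SimpleGraph.Dart.symm ⟨(a, b), hab⟩) := (hsymm _).symm
        _ = x d' := ih _ d' rfl hd'
  obtain ⟨w⟩ := hG.preconnected d.fst d'.fst
  exact hwalk w d d' rfl rfl

variable [DecidableEq V]

/-- The mod 2 edge chain of the boundary walk of a face. -/
noncomputable def faceChain (f : Λ.Face) : G.edgeSet → ZMod 2 :=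
  listChain (Λ.boundaryWalk (Quotient.out f.1))

open Classical in
theorem faceChain_dartEdge (f : Λ.Face) (d : G.Dart) : Λ.faceChain f (dartEdge d) =
    (if Λ.Beside d f then 1 else 0) + if Λ.Beside d.symm f then 1 else 0 := by
  have hmem : ∀ d, d ∈ Λ.boundaryWalk (Quotient.out f.1) ↔ Λ.Beside d f := fun d => by
    rw [mem_boundaryWalk, faceOf_out, Beside]
  rw [faceChain, listChain_dartEdge, (Λ.nodup_boundaryWalk _).count,
    (Λ.nodup_boundaryWalk _).count]
  simp only [hmem, Nat.cast_ite, Nat.cast_one, Nat.cast_zero]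

theorem faceChain_dartEdge_ne_zero_iff {f : Λ.Face} {d : G.Dart} :
    Λ.faceChain f (dartEdge d) ≠ 0 ↔ Xor (Λ.Beside d f) (Λ.Beside d.symm f) := by
  rw [faceChain_dartEdge]
  by_cases h : Λ.Beside d f <;> by_cases h' : Λ.Beside d.symm f <;>
    simp [h, h', Xor, CharTwo.add_self_eq_zero]

theorem bdry_faceChain [Fintype G.edgeSet] (f : Λ.Face) : bdry G (Λ.faceChain f) = 0 := by
  obtain ⟨w, hw⟩ := Λ.exists_walk_darts_eq_boundaryWalk (Quotient.out f.1)
  rw [faceChain, ← hw, bdry_listChain_darts, ZModModule.add_self]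

theorem sum_smul_faceChain_dartEdge [Fintype Λ.Face] {t : FaceOf Λ.rot → ZMod 2}
    (ht : ∀ φ, Λ.IsUnbounded φ → t φ = 0) (d : G.Dart) :
    (∑ f : Λ.Face, t f.1 • Λ.faceChain f) (dartEdge d) =
      t (faceOf Λ.rot d) + t (faceOf Λ.rot d.symm) := by
  classical
  have hbeside : ∀ d : G.Dart, (∑ f : Λ.Face, t f.1 * if Λ.Beside d f then 1 else 0) =
      t (faceOf Λ.rot d) := by
    intro d
    by_cases h : Λ.IsUnbounded (faceOf Λ.rot d)
    · rw [ht _ h]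
      refine Finset.sum_eq_zero fun f _ => ?_
      have hf : ¬ Λ.Beside d f := fun hf => f.2 (hf ▸ h)
      rw [if_neg hf, mul_zero]
    · rw [Finset.sum_eq_single ⟨faceOf Λ.rot d, h⟩ (fun f _ hne => ?_)
        (absurd (Finset.mem_univ _))]
      · exact (congrArg _ (if_pos rfl)).trans (mul_one _)
      · rw [if_neg fun hf => hne (Subtype.ext hf.symm), mul_zero]
  simp only [Finset.sum_apply, Pi.smul_apply, faceChain_dartEdge, smul_eq_mul, mul_add,
    Finset.sum_add_distrib, hbeside]

/-- A linear relation between the face chains is a function on the faces, zero on the unbounded one,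
that takes the same value on both sides of every edge; on a connected graph it is constant. -/
theorem linearIndependent_faceChain (hG : G.Connected) :
    LinearIndependent (ZMod 2) Λ.faceChain := by
  classical
  have := Fintype.ofFinite Λ.Face
  rw [Fintype.linearIndependent_iff]
  intro s hs f
  obtain ⟨t, hts, ht⟩ : ∃ t : FaceOf Λ.rot → ZMod 2,
      (∀ f : Λ.Face, t f.1 = s f) ∧ ∀ φ, Λ.IsUnbounded φ → t φ = 0 :=
    ⟨fun φ => if h : Λ.IsUnbounded φ then 0 else s ⟨φ, h⟩, fun f => dif_neg f.2,
      fun _ h => dif_pos h⟩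
  simp only [← hts] at hs ⊢
  have hsymm : ∀ d : G.Dart, t (faceOf Λ.rot d.symm) = t (faceOf Λ.rot d) := fun d => by
    rw [eq_comm, ← CharTwo.add_eq_zero, ← Λ.sum_smul_faceChain_dartEdge ht, hs, Pi.zero_apply]
  have hrot : ∀ d : G.Dart, t (faceOf Λ.rot (Λ.rot d)) = t (faceOf Λ.rot d) := fun d => by
    rw [faceOf_rot, hsymm]
  obtain ⟨d, hd⟩ := faceOf_surjective Λ.rot f.1
  obtain ⟨φ, hφ, -⟩ := Λ.existsUnique_isUnbounded ⟨d⟩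
  obtain ⟨d', rfl⟩ := faceOf_surjective Λ.rot φ
  calc t f.1 = t (faceOf Λ.rot d) := by rw [hd]
    _ = t (faceOf Λ.rot d') :=
      Λ.eq_of_connected hG (x := fun d => t (faceOf Λ.rot d)) hsymm hrot d d'
    _ = 0 := ht _ hφ

theorem span_range_faceChain [Fintype G.edgeSet] (hG : G.Connected) :
    Submodule.span (ZMod 2) (Set.range Λ.faceChain) = LinearMap.ker (bdry G) := by
  have := Fintype.ofFinite Λ.Face
  refine Submodule.eq_of_le_of_finrank_le ?_ ?_
  · exact Submodule.span_le.2 (Set.range_subset_iff.2 Λ.bdry_faceChain)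
  · rw [finrank_span_eq_card (Λ.linearIndependent_faceChain hG)]
    have hker := finrank_ker_bdry_add_card_le hG
    have heuler := Λ.euler
    rw [Nat.card_eq_fintype_card (α := G.edgeSet), show Nat.card {f // ¬ Λ.IsUnbounded f} =
      Fintype.card Λ.Face from Nat.card_eq_fintype_card (α := Λ.Face)] at heuler
    lia

theorem finrank_ker_bdry [Fintype G.edgeSet] (hG : G.Connected) :
    Module.finrank (ZMod 2) (LinearMap.ker (bdry G)) = Nat.card Λ.Face := by
  have := Fintype.ofFinite Λ.Face
  rw [← Λ.span_range_faceChain hG, finrank_span_eq_card (Λ.linearIndependent_faceChain hG),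
    Nat.card_eq_fintype_card]

theorem apply_dartEdge_eq_zero_of_faceOf_eq [Fintype G.edgeSet] (hG : G.Connected)
    {c : G.edgeSet → ZMod 2} (hc : bdry G c = 0) {d : G.Dart}
    (hd : faceOf Λ.rot d = faceOf Λ.rot d.symm) : c (dartEdge d) = 0 := by
  have hle : Submodule.span (ZMod 2) (Set.range Λ.faceChain) ≤
      LinearMap.ker (LinearMap.proj (dartEdge d)) := by
    refine Submodule.span_le.2 (Set.range_subset_iff.2 fun f => ?_)
    by_contra h
    exact (Λ.faceChain_dartEdge_ne_zero_iff.1 h).elim (by simp [Beside, hd]) (by simp [Beside, hd])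
  rw [Λ.span_range_faceChain hG] at hle
  exact hle hc

end PlaneEmbedding

end Faces

section MajoranaGroup

variable {V : Type*} {G : SimpleGraph V}

theorem mk_eq_mk_of_rel {a b : FreeGroup (Gen G)} (h : Rel G a b) :
    (PresentedGroup.mk {r | ∃ a b, Rel G a b ∧ r = a * b⁻¹} a : MajoranaGroup G) =
      PresentedGroup.mk _ b :=
  PresentedGroup.mk_eq_mk_of_mul_inv_mem ⟨a, b, h, rfl⟩

theorem gen_edge_symm (d : G.Dart) : (gen (.edge d) : MajoranaGroup G) =
    gen (.phase 2) * gen (.edge d.symm) :=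
  mk_eq_mk_of_rel (.edge_symm d)

theorem gen_edge_mul_gen_edge {d d' : G.Dart} (h₁ : d.snd = d'.fst) (h₂ : d.fst ≠ d'.snd) :
    (gen (.edge d) * gen (.edge d') : MajoranaGroup G) =
      gen (.phase 2) * (gen (.edge d') * gen (.edge d)) :=
  mk_eq_mk_of_rel (.edge_edge_anticomm d d' h₁ h₂)

theorem PlaneEmbedding.faceCycle_mem_cycleGroup [Fintype V] (Λ : PlaneEmbedding G) (f : Λ.Face) :
    Λ.faceCycle f ∈ cycleGroup G := by
  obtain ⟨w, hw⟩ := Λ.exists_walk_darts_eq_boundaryWalk (Quotient.out f.1)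
  exact Subgroup.subset_closure ⟨_, w, congrArg pathElt hw.symm⟩

end MajoranaGroup

namespace Encoding

section Label

variable {V : Type*} {G : SimpleGraph V} {Q : Type*} [Fintype Q] [DecidableEq Q]
  (ε : Encoding G Q)

/-- The symplectic coordinates of the operator representing an element of `M_G`. -/
noncomputable def label (m : MajoranaGroup G) : PauliVec Q := pauliLabel (ε.σ m : QubitOp Q)

theorem label_mul (m n : MajoranaGroup G) : ε.label (m * n) = ε.label m + ε.label n := by
  rw [label, map_mul, Units.val_mul, (ε.isPauliOp m).pauliLabel_mul (ε.isPauliOp n), label, label]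

theorem label_phase (k : ZMod 4) : ε.label (gen (.phase k)) = 0 := by
  rw [label, ε.phase_op, pauliLabel_iPow_smul_one]

theorem label_one : ε.label 1 = 0 := by
  have h := ε.label_mul 1 1
  rwa [mul_one, left_eq_add] at h

theorem label_inv (m : MajoranaGroup G) : ε.label m⁻¹ = -ε.label m := by
  rw [eq_neg_iff_add_eq_zero, ← label_mul, inv_mul_cancel, label_one]

theorem eq_one_of_label_eq_zero {m : MajoranaGroup G} (hm : m ∈ cycleGroup G)
    (h : ε.label m = 0) : ε.σ m = 1 := by
  have hneg : ∀ n ∈ cycleGroup G, (ε.σ n : QubitOp Q) ≠ iPow 2 • 1 := fun n hn hn2 =>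
    ε.neg_one_notMem ⟨n, hn, Units.ext <| by
      rw [hn2, iPow_two, neg_one_smul, Units.val_neg, Units.val_one]⟩
  obtain ⟨k, hk⟩ := (ε.isPauliOp m).exists_eq_smul_one h
  have hsq : (ε.σ (m * m) : QubitOp Q) = iPow (k + k) • 1 := by
    rw [map_mul, Units.val_mul, hk, smul_mul_smul_comm, ← iPow_add, one_mul]
  have hcases : ∀ k : ZMod 4, k = 0 ∨ k = 2 ∨ k + k = 2 := by decide
  rcases hcases k with rfl | rfl | h2
  · exact Units.ext (by rw [hk, iPow_zero, one_smul, Units.val_one])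
  · exact absurd hk (hneg m hm)
  · exact absurd (h2 ▸ hsq) (hneg _ (mul_mem hm hm))

theorem mem_kernel_iff {m : MajoranaGroup G} (hm : m ∈ cycleGroup G) :
    m ∈ ε.kernel ↔ ε.label m = 0 := by
  refine ⟨fun h => ?_, fun h => ⟨hm, MonoidHom.mem_ker.2 (ε.eq_one_of_label_eq_zero hm h)⟩⟩
  rw [label, MonoidHom.mem_ker.1 h.2, ← map_one ε.σ]
  exact ε.label_one

theorem label_edge_symm (d : G.Dart) :
    ε.label (gen (.edge d.symm)) = ε.label (gen (.edge d)) := by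
  rw [gen_edge_symm d, label_mul, label_phase, zero_add]

/-- The symplectic coordinates of the operator representing an edge, which are the same for both of
its darts. -/
noncomputable def edgeLabel (e : G.edgeSet) : PauliVec Q :=
  ε.label (gen (.edge (Function.surjInv dartEdge_surjective e)))

theorem edgeLabel_dartEdge (d : G.Dart) : ε.edgeLabel (dartEdge d) = ε.label (gen (.edge d)) := by
  rw [edgeLabel]
  rcases dartEdge_eq_iff.1 (Function.surjInv_eq dartEdge_surjective (dartEdge d)) with h | h
  · rw [h]
  · rw [h, label_edge_symm]

theorem not_commute_edge {d d' : G.Dart} (h₁ : d.snd = d'.fst) (h₂ : d.fst ≠ d'.snd) :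
    ¬ Commute (ε.σ (gen (.edge d)) : QubitOp Q) (ε.σ (gen (.edge d')) : QubitOp Q) := by
  intro hcomm
  have hanti := congrArg (fun m => (ε.σ m : QubitOp Q)) (gen_edge_mul_gen_edge h₁ h₂)
  simp only [map_mul, Units.val_mul, ε.phase_op, iPow_two, neg_smul, one_smul, neg_mul,
    one_mul] at hanti
  rw [hcomm.eq, eq_neg_iff_add_eq_zero, ← two_smul ℂ, smul_eq_zero_iff_right two_ne_zero] at hanti
  exact (ε.σ (gen (.edge d')) * ε.σ (gen (.edge d))).ne_zero hanti

/-- Edges sharing exactly one vertex anticommute, so they carry different letters on some common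
qubit. -/
theorem exists_edgeLabel_ne {e e' : G.edgeSet} (hne : e ≠ e') {v : V} (hv : v ∈ e.1)
    (hv' : v ∈ e'.1) :
    ∃ q, ε.edgeLabel e q ≠ 0 ∧ ε.edgeLabel e' q ≠ 0 ∧ ε.edgeLabel e q ≠ ε.edgeLabel e' q := by
  obtain ⟨d, rfl, hd⟩ := exists_dart_snd_eq hv
  obtain ⟨d', rfl, hd'⟩ := exists_dart_snd_eq hv'
  have hfst : d.fst ≠ d'.fst := fun h =>
    hne (congrArg dartEdge (SimpleGraph.Dart.ext _ _ (Prod.ext h (hd.trans hd'.symm))))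
  by_contra! hall
  refine ε.not_commute_edge (d := d) (d' := d'.symm) (hd.trans hd'.symm) hfst ?_
  refine (ε.isPauliOp _).commute_of_pauliLabel (ε.isPauliOp _) fun q => ?_
  have hq := hall q
  rw [edgeLabel_dartEdge, edgeLabel_dartEdge, ← ε.label_edge_symm d'] at hq
  by_cases h : ε.label (gen (.edge d)) q = 0
  · exact .inl h
  · exact .inr (or_iff_not_imp_left.2 (hq h))

end Label

section ChainLabel

variable {V : Type*} {G : SimpleGraph V} {Q : Type*} [Fintype Q] [DecidableEq Q]
  [Fintype G.edgeSet] (ε : Encoding G Q)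

/-- The symplectic coordinates of the products of edges, as a linear map on edge chains. -/
noncomputable def chainLabel : (G.edgeSet → ZMod 2) →ₗ[ZMod 2] PauliVec Q :=
  Fintype.linearCombination (ZMod 2) ε.edgeLabel

theorem chainLabel_apply (u : G.edgeSet → ZMod 2) (q : Q) :
    ε.chainLabel u q = ∑ e, u e • ε.edgeLabel e q := by
  simp only [chainLabel, Fintype.linearCombination_apply, Finset.sum_apply, Pi.smul_apply]

variable [DecidableEq V]

theorem chainLabel_dartChain (d : G.Dart) :
    ε.chainLabel (dartChain d) = ε.label (gen (.edge d)) := by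
  rw [dartChain, chainLabel, Fintype.linearCombination_apply_single, one_smul, edgeLabel_dartEdge]

theorem label_pathElt (l : List G.Dart) : ε.label (pathElt l) = ε.chainLabel (listChain l) := by
  rw [pathElt, label_mul, label_phase, zero_add]
  induction l with
  | nil => rw [List.map_nil, List.prod_nil, label_one, listChain_nil, map_zero]
  | cons d l ih =>
    rw [List.map_cons, List.prod_cons, label_mul, ih, listChain_cons, map_add,
      chainLabel_dartChain]

theorem faceCycle_mem_kernel_iff [Fintype V] {Λ : PlaneEmbedding G} {f : Λ.Face} :
    Λ.faceCycle f ∈ ε.kernel ↔ ε.chainLabel (Λ.faceChain f) = 0 := by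
  rw [ε.mem_kernel_iff (Λ.faceCycle_mem_cycleGroup f), PlaneEmbedding.faceCycle,
    PlaneEmbedding.faceChain, label_pathElt]

theorem label_mem_map_ker_bdry {m : MajoranaGroup G} (hm : m ∈ cycleGroup G) :
    ε.label m ∈ (LinearMap.ker (bdry G)).map ε.chainLabel := by
  induction hm using Subgroup.closure_induction with
  | mem m hm =>
    obtain ⟨v, w, rfl⟩ := hm
    refine ⟨listChain w.darts, ?_, (ε.label_pathElt _).symm⟩
    rw [SetLike.mem_coe, LinearMap.mem_ker, bdry_listChain_darts, ZModModule.add_self]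
  | one => rw [label_one]; exact zero_mem _
  | mul m n _ _ hm hn => rw [label_mul]; exact add_mem hm hn
  | inv m _ hm => rw [label_inv]; exact neg_mem hm

theorem exists_label_eq [Fintype V] (hG : G.Connected) (Λ : PlaneEmbedding G)
    {c : G.edgeSet → ZMod 2} (hc : bdry G c = 0) :
    ∃ m ∈ cycleGroup G, ε.label m = ε.chainLabel c := by
  rw [← LinearMap.mem_ker, ← Λ.span_range_faceChain hG] at hc
  induction hc using Submodule.span_induction with
  | mem c hc =>
    obtain ⟨f, rfl⟩ := hc
    exact ⟨Λ.faceCycle f, Λ.faceCycle_mem_cycleGroup f, ε.label_pathElt _⟩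
  | zero => exact ⟨1, one_mem _, by rw [label_one, map_zero]⟩
  | add b c _ _ hb hc =>
    obtain ⟨m, hm, hmb⟩ := hb
    obtain ⟨n, hn, hnc⟩ := hc
    exact ⟨m * n, mul_mem hm hn, by rw [label_mul, hmb, hnc, map_add]⟩
  | smul r c _ hc =>
    obtain ⟨m, hm, hmc⟩ := hc
    have hr : ∀ r : ZMod 2, r = 0 ∨ r = 1 := by decide
    rcases hr r with rfl | rfl
    · exact ⟨1, one_mem _, by rw [label_one, zero_smul, map_zero]⟩
    · exact ⟨m, hm, by rw [hmc, one_smul]⟩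

/-- The symplectic coordinates of the elements of the stabilizer group. -/
noncomputable def stabilizerLabel :
    ε.stabilizer →* Multiplicative ((LinearMap.ker (bdry G)).map ε.chainLabel) :=
  MonoidHom.mk'
    (fun s => .ofAdd ⟨pauliLabel (s.1 : QubitOp Q), by
      obtain ⟨_, m, hm, rfl⟩ := s
      exact ε.label_mem_map_ker_bdry hm⟩)
    (by
      rintro ⟨_, m, hm, rfl⟩ ⟨_, n, hn, rfl⟩
      exact congrArg Multiplicative.ofAdd (Subtype.ext
        ((ε.isPauliOp m).pauliLabel_mul (ε.isPauliOp n))))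

theorem stabilizerLabel_injective : Function.Injective ε.stabilizerLabel := by
  rw [injective_iff_map_eq_one]
  rintro ⟨_, m, hm, rfl⟩ h
  exact Subtype.ext (ε.eq_one_of_label_eq_zero hm (congrArg Subtype.val h))

theorem stabilizerLabel_surjective [Fintype V] (hG : G.Connected) (Λ : PlaneEmbedding G) :
    Function.Surjective ε.stabilizerLabel := by
  rintro ⟨_, c, hc, rfl⟩
  obtain ⟨m, hm, hmc⟩ := ε.exists_label_eq hG Λ hc
  exact ⟨⟨ε.σ m, m, hm, rfl⟩, Subtype.ext hmc⟩

theorem rank_stabilizer [Fintype V] (hG : G.Connected) (Λ : PlaneEmbedding G) :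
    Group.rank ε.stabilizer =
      Module.finrank (ZMod 2) ((LinearMap.ker (bdry G)).map ε.chainLabel) := by
  let φ : ε.stabilizer ≃* Multiplicative ((LinearMap.ker (bdry G)).map ε.chainLabel) :=
    MulEquiv.ofBijective ε.stabilizerLabel
      ⟨ε.stabilizerLabel_injective, ε.stabilizerLabel_surjective hG Λ⟩
  have : Group.FG (Multiplicative ((LinearMap.ker (bdry G)).map ε.chainLabel)) :=
    Group.fg_of_surjective φ.surjective
  rw [Group.rank_congr φ, rank_multiplicative_eq_finrank (p := 2)]

end ChainLabel

end Encoding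

namespace Weight3PlanarEncoding

section EdgeLabel

variable {V : Type*} [Fintype V] [DecidableEq V] {G : SimpleGraph V} {Λ : PlaneEmbedding G}
  {A : Type*} [Fintype A] [DecidableEq A] (ε : Weight3PlanarEncoding Λ A)

theorem edgeLabel_inl_of_mem {e : G.edgeSet} {v : V} (hv : v ∈ e.1) :
    ε.edgeLabel e (.inl v) = (1, 0) ∨ ε.edgeLabel e (.inl v) = (1, 1) := by
  obtain ⟨d, rfl⟩ := dartEdge_surjective e
  obtain ⟨k, P, hP, hfst, hsnd, -⟩ := ε.edge_op d
  rw [ε.edgeLabel_dartEdge, Encoding.label, hP, pauliLabel_smul_pauliString]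
  rcases mem_dartEdge.1 hv with rfl | rfl
  · exact hfst.imp (congrArg Pauli.vec) (congrArg Pauli.vec)
  · exact hsnd.imp (congrArg Pauli.vec) (congrArg Pauli.vec)

theorem edgeLabel_inl_of_notMem {e : G.edgeSet} {v : V} (hv : v ∉ e.1) :
    ε.edgeLabel e (.inl v) = 0 := by
  obtain ⟨d, rfl⟩ := dartEdge_surjective e
  obtain ⟨k, P, hP, -, -, hI, -⟩ := ε.edge_op d
  rw [mem_dartEdge, not_or] at hv
  rw [ε.edgeLabel_dartEdge, Encoding.label, hP, pauliLabel_smul_pauliString]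
  exact Pauli.vec_eq_zero_iff.2 (hI v hv.1 hv.2)

theorem mem_of_edgeLabel_inl_ne_zero {e : G.edgeSet} {v : V} (h : ε.edgeLabel e (.inl v) ≠ 0) :
    v ∈ e.1 :=
  by_contra fun hv => h (ε.edgeLabel_inl_of_notMem hv)

theorem edgeLabel_inl_ne (e : G.edgeSet) (v : V) : ε.edgeLabel e (.inl v) ≠ (0, 1) := by
  by_cases hv : v ∈ e.1
  · rcases ε.edgeLabel_inl_of_mem hv with h | h <;> rw [h] <;> decide
  · rw [ε.edgeLabel_inl_of_notMem hv]
    decide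

theorem adjacent_of_edgeLabel_ne_zero {d : G.Dart} {a : A}
    (h : ε.edgeLabel (dartEdge d) (.inr a) ≠ 0) : Λ.Adjacent d (ε.face a) := by
  obtain ⟨k, P, hP, -, -, -, hadj, -⟩ := ε.edge_op d
  rw [ε.edgeLabel_dartEdge, Encoding.label, hP, pauliLabel_smul_pauliString] at h
  exact hadj a (mt Pauli.vec_eq_zero_iff.2 h)

theorem eq_of_edgeLabel_ne_zero {e : G.edgeSet} {a b : A}
    (ha : ε.edgeLabel e (.inr a) ≠ 0) (hb : ε.edgeLabel e (.inr b) ≠ 0) : a = b := by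
  obtain ⟨d, rfl⟩ := dartEdge_surjective e
  obtain ⟨k, P, hP, -, -, -, -, huniq⟩ := ε.edge_op d
  rw [ε.edgeLabel_dartEdge, Encoding.label, hP, pauliLabel_smul_pauliString] at ha hb
  exact huniq a b (mt Pauli.vec_eq_zero_iff.2 ha) (mt Pauli.vec_eq_zero_iff.2 hb)

theorem exists_common_auxiliary {e e' : G.edgeSet} (hne : e ≠ e') {v : V} (hv : v ∈ e.1)
    (hv' : v ∈ e'.1) (hletter : ε.edgeLabel e (.inl v) = ε.edgeLabel e' (.inl v)) :
    ∃ a, ε.edgeLabel e (.inr a) ≠ 0 ∧ ε.edgeLabel e' (.inr a) ≠ 0 := by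
  obtain ⟨w | a, hq, hq', hqne⟩ := ε.exists_edgeLabel_ne hne hv hv'
  · have hvw : v ≠ w := fun h => hqne (h ▸ hletter)
    exact absurd (Subtype.ext (Sym2.eq_of_ne_mem hvw hv (ε.mem_of_edgeLabel_inl_ne_zero hq) hv'
      (ε.mem_of_edgeLabel_inl_ne_zero hq'))) hne
  · exact ⟨a, hq, hq'⟩

theorem edgeLabel_inr_ne_zero_of_same_letter {e e' : G.edgeSet} {v : V}
    (hv : ε.edgeLabel e (.inl v) ≠ 0)
    (hletter : ε.edgeLabel e (.inl v) = ε.edgeLabel e' (.inl v)) {a : A}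
    (ha : ε.edgeLabel e (.inr a) ≠ 0) : ε.edgeLabel e' (.inr a) ≠ 0 := by
  by_cases hne : e = e'
  · rwa [← hne]
  · obtain ⟨b, hb, hb'⟩ := ε.exists_common_auxiliary hne (ε.mem_of_edgeLabel_inl_ne_zero hv)
      (ε.mem_of_edgeLabel_inl_ne_zero (hletter ▸ hv)) hletter
    rwa [ε.eq_of_edgeLabel_ne_zero ha hb]

/-- The part of an edge chain on the edges that act on the auxiliary qubit `a`. -/
noncomputable def auxPart (c : G.edgeSet → ZMod 2) (a : A) : G.edgeSet → ZMod 2 :=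
  Set.indicator {e | ε.edgeLabel e (.inr a) ≠ 0} c

theorem auxPart_of_ne_zero {c : G.edgeSet → ZMod 2} {e : G.edgeSet} {a : A}
    (h : ε.edgeLabel e (.inr a) ≠ 0) :
    ε.auxPart c a e = c e :=
  Set.indicator_of_mem h c

theorem auxPart_of_eq_zero {c : G.edgeSet → ZMod 2} {e : G.edgeSet} {a : A}
    (h : ε.edgeLabel e (.inr a) = 0) :
    ε.auxPart c a e = 0 :=
  Set.indicator_of_notMem (not_not.2 h) c

end EdgeLabel

section Kernel

variable {V : Type*} [Fintype V] [DecidableEq V] {G : SimpleGraph V} [Fintype G.edgeSet]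
  {Λ : PlaneEmbedding G} {A : Type*} [Fintype A] [DecidableEq A] (ε : Weight3PlanarEncoding Λ A)
  {c : G.edgeSet → ZMod 2}

theorem fst_chainLabel_inl (c : G.edgeSet → ZMod 2) (v : V) :
    (ε.chainLabel c (.inl v)).1 = bdry G c v := by
  rw [ε.chainLabel_apply, Prod.fst_sum, bdry_apply, Finset.sum_filter]
  refine Finset.sum_congr rfl fun e _ => ?_
  rw [Prod.smul_fst, smul_eq_mul]
  split_ifs with hv
  · rcases ε.edgeLabel_inl_of_mem hv with h | h <;> rw [h, mul_one]
  · rw [ε.edgeLabel_inl_of_notMem hv, Prod.fst_zero, mul_zero]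

theorem ker_chainLabel_le_ker_bdry : LinearMap.ker ε.chainLabel ≤ LinearMap.ker (bdry G) :=
  fun c hc => funext fun v => by
    rw [← ε.fst_chainLabel_inl, LinearMap.mem_ker.1 hc, Pi.zero_apply, Prod.fst_zero, Pi.zero_apply]

theorem chainLabel_inl_eq_zero_iff (c : G.edgeSet → ZMod 2) (v : V) :
    ε.chainLabel c (.inl v) = 0 ↔ ∀ l ≠ 0, ∑ e with ε.edgeLabel e (.inl v) = l, c e = 0 := by
  rw [ε.chainLabel_apply, sum_smul_eq_zero_iff fun e => ε.edgeLabel_inl_ne e v]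

/-- Edges with the same letter at a vertex act on the same auxiliary qubits, so `auxPart` keeps
either all or none of them. -/
theorem chainLabel_auxPart_inl {v : V} (hc : ε.chainLabel c (.inl v) = 0) (a : A) :
    ε.chainLabel (ε.auxPart c a) (.inl v) = 0 := by
  rw [chainLabel_inl_eq_zero_iff] at hc ⊢
  intro l hl
  by_cases h : ∃ e, ε.edgeLabel e (.inl v) = l ∧ ε.edgeLabel e (.inr a) ≠ 0
  · obtain ⟨e, rfl, hea⟩ := h
    rw [← hc _ hl]
    refine Finset.sum_congr rfl fun e' he' => ε.auxPart_of_ne_zero ?_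
    exact ε.edgeLabel_inr_ne_zero_of_same_letter hl (Finset.mem_filter.1 he').2.symm hea
  · push Not at h
    exact Finset.sum_eq_zero fun e he => ε.auxPart_of_eq_zero (h e (Finset.mem_filter.1 he).2)

theorem chainLabel_auxPart_inr_self (c : G.edgeSet → ZMod 2) (a : A) :
    ε.chainLabel (ε.auxPart c a) (.inr a) = ε.chainLabel c (.inr a) := by
  rw [ε.chainLabel_apply, ε.chainLabel_apply]
  refine Finset.sum_congr rfl fun e _ => ?_
  by_cases h : ε.edgeLabel e (.inr a) = 0
  · rw [h, smul_zero, smul_zero]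
  · rw [ε.auxPart_of_ne_zero h]

theorem chainLabel_auxPart_inr_of_ne (c : G.edgeSet → ZMod 2) {a b : A} (hab : a ≠ b) :
    ε.chainLabel (ε.auxPart c a) (.inr b) = 0 := by
  rw [ε.chainLabel_apply]
  refine Finset.sum_eq_zero fun e _ => ?_
  by_cases h : ε.edgeLabel e (.inr b) = 0
  · rw [h, smul_zero]
  · rw [ε.auxPart_of_eq_zero (by_contra fun ha => hab (ε.eq_of_edgeLabel_ne_zero ha h)), zero_smul]

theorem chainLabel_auxPart (hc : ε.chainLabel c = 0) (a : A) :
    ε.chainLabel (ε.auxPart c a) = 0 := by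
  funext q
  rcases q with v | b
  · exact ε.chainLabel_auxPart_inl (congrFun hc _) a
  · obtain rfl | hab := eq_or_ne a b
    · rw [chainLabel_auxPart_inr_self, hc]
    · exact ε.chainLabel_auxPart_inr_of_ne c hab

/-- If an edge of the chain acts on no auxiliary qubit, it is the only edge of the chain with its
letter at an endpoint, and the letter is not cancelled. -/
theorem exists_auxiliary_of_ne_zero (hc : ε.chainLabel c = 0) {e : G.edgeSet} (he : c e ≠ 0) :
    ∃ a, ε.edgeLabel e (.inr a) ≠ 0 := by
  obtain ⟨d, rfl⟩ := dartEdge_surjective e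
  have hv : d.fst ∈ (dartEdge d).1 := mem_dartEdge.2 (.inl rfl)
  have hletter : ε.edgeLabel (dartEdge d) (.inl d.fst) ≠ 0 := by
    rcases ε.edgeLabel_inl_of_mem hv with h | h <;> rw [h] <;> decide
  have hsum := (ε.chainLabel_inl_eq_zero_iff c d.fst).1 (congrFun hc _) _ hletter
  by_contra! hno
  refine he ?_
  rw [← hsum, Finset.sum_eq_single_of_mem (dartEdge d) (by simp) fun e' he' hne => ?_]
  have heq := (Finset.mem_filter.1 he').2
  obtain ⟨a, -, ha⟩ := ε.exists_common_auxiliary hne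
    (ε.mem_of_edgeLabel_inl_ne_zero (heq ▸ hletter)) hv heq
  exact absurd (hno a) ha

theorem sum_auxPart (hc : ε.chainLabel c = 0) : ∑ a, ε.auxPart c a = c := by
  funext e
  rw [Finset.sum_apply]
  by_cases he : c e = 0
  · rw [he]
    exact Finset.sum_eq_zero fun a _ => Set.indicator_apply_eq_zero.2 fun _ => he
  · obtain ⟨a, ha⟩ := ε.exists_auxiliary_of_ne_zero hc he
    rw [Fintype.sum_eq_single a fun b hb => ?_, ε.auxPart_of_ne_zero ha]
    exact ε.auxPart_of_eq_zero (by_contra fun h => hb (ε.eq_of_edgeLabel_ne_zero h ha))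

theorem auxPart_eq_smul_faceChain (hG : G.Connected) (hc : ε.chainLabel c = 0) {a : A}
    (hface : Λ.BoundedByCycle (ε.face a)) :
    ∃ s : ZMod 2, ε.auxPart c a = s • Λ.faceChain (ε.face a) := by
  obtain ⟨v, p, hp, hedges⟩ := hface
  refine exists_eq_smul_of_support_subset_cycle hp ?_ ?_
    (ε.ker_chainLabel_le_ker_bdry (ε.chainLabel_auxPart hc a)) (Λ.bdry_faceChain _)
  · intro e he
    obtain ⟨d, rfl⟩ := dartEdge_surjective e
    have ha : ε.edgeLabel (dartEdge d) (.inr a) ≠ 0 := mt ε.auxPart_of_eq_zero he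
    rw [ε.auxPart_of_ne_zero ha] at he
    refine (hedges d).2 ((xor_iff_or_and_not_and _ _).2 ⟨ε.adjacent_of_edgeLabel_ne_zero ha, ?_⟩)
    rintro ⟨hd, hd'⟩
    exact he (Λ.apply_dartEdge_eq_zero_of_faceOf_eq hG (ε.ker_chainLabel_le_ker_bdry hc)
      (hd.trans hd'.symm))
  · intro e
    obtain ⟨d, rfl⟩ := dartEdge_surjective e
    rw [Λ.faceChain_dartEdge_ne_zero_iff]
    exact (hedges d).symm

theorem ker_chainLabel_eq_span (hG : G.Connected) (hface : ∀ a, Λ.BoundedByCycle (ε.face a)) :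
    LinearMap.ker ε.chainLabel =
      Submodule.span (ZMod 2) (Λ.faceChain '' {f | Λ.faceCycle f ∈ ε.kernel}) := by
  apply le_antisymm
  · intro c hc
    rw [← ε.sum_auxPart hc]
    refine sum_mem fun a _ => ?_
    have hker := ε.chainLabel_auxPart hc a
    obtain ⟨s, hs⟩ := ε.auxPart_eq_smul_faceChain hG hc (hface a)
    rw [hs] at hker ⊢
    by_cases hs0 : s = 0
    · rw [hs0, zero_smul]
      exact zero_mem _
    · rw [map_smul, smul_eq_zero_iff_right hs0, ← ε.faceCycle_mem_kernel_iff] at hker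
      exact Submodule.smul_mem _ _ (Submodule.subset_span (Set.mem_image_of_mem _ hker))
  · rw [Submodule.span_le]
    rintro _ ⟨f, hf, rfl⟩
    exact ε.faceCycle_mem_kernel_iff.1 hf

theorem finrank_ker_chainLabel (hG : G.Connected) (hface : ∀ a, Λ.BoundedByCycle (ε.face a)) :
    Module.finrank (ZMod 2) (LinearMap.ker ε.chainLabel) = ε.numFaceCyclesInKernel := by
  classical
  have := Fintype.ofFinite Λ.Face
  rw [ε.ker_chainLabel_eq_span hG hface, numFaceCyclesInKernel, Set.image_eq_range,
    Nat.card_eq_fintype_card]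
  exact finrank_span_eq_card ((Λ.linearIndependent_faceChain hG).comp _ Subtype.val_injective)

end Kernel

section Counting

variable {V : Type*} [Fintype V] [DecidableEq V] {G : SimpleGraph V} {Λ : PlaneEmbedding G}
  {A : Type*} [Fintype A] [DecidableEq A] (ε : Weight3PlanarEncoding Λ A)

theorem rank_stabilizer_add_numFaceCyclesInKernel (hG : G.Connected)
    (hface : ∀ a, Λ.BoundedByCycle (ε.face a)) :
    Group.rank ε.stabilizer + ε.numFaceCyclesInKernel = Nat.card Λ.Face := by
  have := Fintype.ofFinite G.edgeSet
  have hrank_nullity :=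
    (ε.chainLabel.domRestrict (LinearMap.ker (bdry G))).finrank_range_add_finrank_ker
  rwa [LinearMap.range_domRestrict, ← ε.rank_stabilizer hG Λ, LinearMap.ker_domRestrict,
    (Submodule.comapSubtypeEquivOfLe ε.ker_chainLabel_le_ker_bdry).finrank_eq,
    ε.finrank_ker_chainLabel hG hface, Λ.finrank_ker_bdry hG] at hrank_nullity

theorem numEmptyFaces_add_card : ε.numEmptyFaces + Fintype.card A = Nat.card Λ.Face := by
  classical
  rw [numEmptyFaces, ← Nat.card_eq_fintype_card, ← Nat.card_range_of_injective ε.face_injective,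
    add_comm, ← Nat.card_sum]
  exact Nat.card_congr (Equiv.sumCompl (· ∈ Set.range ε.face))

end Counting

end Weight3PlanarEncoding

end FermionicEncoding

theorem mainTheorem5 {V A : Type*} [Fintype V] [DecidableEq V] [Fintype A] [DecidableEq A]
    (G : SimpleGraph V) (hG : G.Connected) (Λ : FermionicEncoding.PlaneEmbedding G)
    (ε : FermionicEncoding.Weight3PlanarEncoding Λ A)
    (hface : ∀ a : A, Λ.BoundedByCycle (ε.face a)) :
    ε.disparity = (ε.numFaceCyclesInKernel : ℤ) - (ε.numEmptyFaces : ℤ) := by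
  have hrank : Group.rank ε.stabilizer + ε.numFaceCyclesInKernel = Nat.card Λ.Face :=
    ε.rank_stabilizer_add_numFaceCyclesInKernel hG hface
  have hempty : ε.numEmptyFaces + Fintype.card A = Nat.card Λ.Face := ε.numEmptyFaces_add_card
  rw [FermionicEncoding.Encoding.disparity, Fintype.card_sum]
  lia
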